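/- Let $S^1=\mathbb{R}/\mathbb{Z}$, let $D^2$ be the closed unit disc, and give the solid torus $S^1\times D^2$ the coordinates $(y,(x,t))$, where $y\in\mathbb{R}/\mathbb{Z}$ is the longitudinal coordinate, and $x\in\mathbb{R}/\mathbb{Z}$ (angle divided by $2\pi$, the meridional direction) and $t\in[0,1]$ (radius) are polar coordinates on $D^2$. Let $c_3$ be the involution $(y,(x,t))\mapsto(y+\tfrac12,(x,t))$. A smooth co-oriented contact structure $\xi$ on $S^1\times D^2$ is called $c_3$-real if $(c_3)_*\xi=-\xi$, i.e. $c_3$ preserves the plane field $\xi$ and reverses its co-orientation. It is called tight if there is no smoothly embedded closed disc in $S^1\times D^2$ that is tangent to $\xi$ at every point of its boundary. The boundary torus $T^2=\partial(S^1\times D^2)=\mathbb{R}^2_{(x,y)}/\mathbb{Z}^2$ is convex if there is a contact vector field $X$ for $\xi$, defined near $T^2$ and transverse to $T^2$; the corresponding dividing set is $\Gamma=\{p\in T^2: X_p\in\xi_p\}$, and $\#\Gamma$ denotes the number of its connected components. The slope of $\Gamma$ is $s\in\mathbb{Q}\cup\{\infty\}$ if each component of $\Gamma$ is isotopic in $T^2$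 to (the image of) a straight line of slope $s=dy/dx$ in $\mathbb{R}^2$; thus slope $0$ is meridional and slope $\infty$ is the direction of $S^1\times\{\mathrm{pt}\}$. Then: (a) there is no $c_3$-real tight contact structure on $S^1\times D^2$ with convex boundary, $\#\Gamma=2$ and slope $\infty$; (b) for every integer $k\neq 0$, there is no $c_3$-real tight contact structure on $S^1\times D^2$ with convex boundary, $\#\Gamma=2$ and slope $\frac{1}{2k}$. -/

import Mathlib

/-!
The solid torus `S¹ × D²`, with `S¹ = ℝ/ℤ` and `D²` the closed unit disc of `ℂ`, is presented as the
quotient of its universal cover `ℝ × D² ⊆ ℝ × ℂ` by the translation `(y, z) ↦ (y + 1, z)`.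
In the coordinates `(y, (x, t))` one has `z = t * exp (2πix)`.
Tensor fields on `S¹ × D²` are tensor fields on `ℝ × D²` invariant under this translation; only their
values on `ℝ × D²` matter.
-/

noncomputable section

namespace SolidTorus

/-- The ambient space `ℝ × ℂ` of the universal cover. -/
abbrev Ambient : Type := ℝ × ℂ

/-- A (not necessarily smooth) field of covectors. -/
abbrev OneForm : Type := Ambient → (Ambient →L[ℝ] ℝ)

/-- The universal cover `ℝ × D²` of the solid torus. -/
def cover : Set Ambient := {p | ‖p.2‖ ≤ 1}

/-- The deck translation by `n ∈ ℤ`; two points of the cover are the same point of `S¹ × D²`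
iff they differ by a deck translation. -/
def deck (n : ℤ) (p : Ambient) : Ambient := (p.1 + n, p.2)

/-- (The lift to the cover of) the real structure `c₃ : (y, (x, t)) ↦ (y + 1/2, (x, t))`. -/
def c3 (p : Ambient) : Ambient := (p.1 + 1 / 2, p.2)

/-- A smooth (up to the boundary) 1-form on `S¹ × D²`. -/
def IsSmoothForm (α : OneForm) : Prop :=
  ContDiffOn ℝ ((⊤ : ℕ∞) : WithTop ℕ∞) α cover ∧ ∀ p ∈ cover, ∀ n : ℤ, α (deck n p) = α p

/-- The exterior derivative `dα (u, v)` at `p`, for constant vectors `u`, `v`. -/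
def extD (α : OneForm) (p u v : Ambient) : ℝ :=
  fderivWithin ℝ α cover p u v - fderivWithin ℝ α cover p v u

/-- `(α ∧ dα) (u, v, w)` at `p`. -/
def wedgeD (α : OneForm) (p u v w : Ambient) : ℝ :=
  α p u * extD α p v w + α p v * extD α p w u + α p w * extD α p u v

/-- `α` is a contact form on `S¹ × D²`: it is smooth and `α ∧ dα` vanishes nowhere.
The co-oriented contact structure is `ξ = ker α`. -/
def IsContactForm (α : OneForm) : Prop :=
  IsSmoothForm α ∧
    ∀ p ∈ cover, wedgeD α p ((1, 0) : Ambient) ((0, 1) : Ambient) ((0, Complex.I) : Ambient) ≠ 0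

/-- The co-oriented plane field `ξ = ker α` is `c₃`-real: `(c₃)_* ξ = -ξ`, that is, `c₃` maps `ξ` to
`ξ` and reverses the co-orientation; in terms of forms, `c₃^* α` is a negative multiple of `α`. -/
def IsC3Real (α : OneForm) : Prop :=
  ∀ p ∈ cover, ∃ r : ℝ, 0 < r ∧ ∀ v : Ambient, α (c3 p) (fderiv ℝ c3 p v) = -(r * α p v)

/-- `f` is (the lift to the cover of) a smooth embedding of the closed unit disc into `S¹ × D²`.
Lifts exist as the disc is simply connected. -/
def IsEmbeddedDisc (f : ℂ → Ambient) : Prop :=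
  ContDiffOn ℝ ((⊤ : ℕ∞) : WithTop ℕ∞) f (Metric.closedBall 0 1) ∧
  Set.MapsTo f (Metric.closedBall 0 1) cover ∧
  (∀ w ∈ Metric.closedBall (0 : ℂ) 1, ∀ w' ∈ Metric.closedBall (0 : ℂ) 1,
    ∀ n : ℤ, f w = deck n (f w') → w = w') ∧
  ∀ w ∈ Metric.closedBall (0 : ℂ) 1,
    Function.Injective (fderivWithin ℝ f (Metric.closedBall 0 1) w)

/-- An overtwisted disc of `ξ = ker α`: an embedded disc whose tangent plane is the contact plane
at every point of its boundary. -/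
def IsOvertwistedDisc (α : OneForm) (f : ℂ → Ambient) : Prop :=
  IsEmbeddedDisc f ∧ ∀ w : ℂ, ‖w‖ = 1 →
    LinearMap.range (fderivWithin ℝ f (Metric.closedBall 0 1) w).toLinearMap
      = LinearMap.ker (α (f w)).toLinearMap

/-- `ξ = ker α` is tight: it has no overtwisted disc. -/
def IsTight (α : OneForm) : Prop := ¬ ∃ f : ℂ → Ambient, IsOvertwistedDisc α f

/-- The (cover of the) collar neighbourhood `1 - ε < t ≤ 1` of the boundary. -/
def collar (ε : ℝ) : Set Ambient := {p | 1 - ε < ‖p.2‖ ∧ ‖p.2‖ ≤ 1}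

/-- The Lie derivative `(L_X α)(v)` at `p`, for a constant vector `v`. -/
def lieD (X : Ambient → Ambient) (α : OneForm) (p v : Ambient) : ℝ :=
  fderivWithin ℝ α cover p (X p) v + α p (fderivWithin ℝ X cover p v)

/-- `X` is a contact vector field for `ker α`, defined on the collar of width `ε`. -/
def IsContactField (α : OneForm) (ε : ℝ) (X : Ambient → Ambient) : Prop :=
  ContDiffOn ℝ ((⊤ : ℕ∞) : WithTop ℕ∞) X (collar ε) ∧
  (∀ p ∈ collar ε, ∀ n : ℤ, X (deck n p) = X p) ∧
  ∃ μ : Ambient → ℝ, ∀ p ∈ collar ε, ∀ v : Ambient, lieD X α p v = μ p * α p v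

/-- `X` is transverse to the boundary `t = 1`: its radial component vanishes nowhere there. -/
def IsTransverse (X : Ambient → Ambient) : Prop :=
  ∀ p : Ambient, ‖p.2‖ = 1 → inner ℝ p.2 (X p).2 ≠ 0

/-- The torus `T² = ℝ²/ℤ²` with coordinates `(x, y)`. -/
abbrev Torus : Type := UnitAddCircle × UnitAddCircle

/-- The projection `ℝ² → ℝ²/ℤ²`. -/
def toTorus (q : ℝ × ℝ) : Torus := ((q.1 : UnitAddCircle), (q.2 : UnitAddCircle))

/-- The identification of `ℝ²/ℤ²` with the boundary of the solid torus (on universal covers):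
`x` is the meridional and `y` the longitudinal coordinate. -/
def boundaryPoint (q : ℝ × ℝ) : Ambient :=
  (q.2, Complex.exp (2 * (Real.pi : ℂ) * (q.1 : ℂ) * Complex.I))

/-- The dividing set of the boundary with respect to `X`: the points where `X` is tangent
to `ξ = ker α`. -/
def dividingSet (α : OneForm) (X : Ambient → Ambient) : Set Torus :=
  toTorus '' {q | α (boundaryPoint q) (X (boundaryPoint q)) = 0}

/-- The connected components of a subset of the torus. -/
def componentsOf (Γ : Set Torus) : Set (Set Torus) :=
  {C | ∃ q ∈ Γ, C = connectedComponentIn Γ q}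

/-- The line through `q` with slope `s ∈ ℚ ∪ {∞}` in `ℝ²`. -/
def line (q : ℝ × ℝ) : OnePoint ℚ → Set (ℝ × ℝ)
  | OnePoint.infty => {p | p.1 = q.1}
  | OnePoint.some m => {p | p.2 - q.2 = (m : ℝ) * (p.1 - q.1)}

/-- Two subsets of the torus are (ambient) isotopic. -/
def Isotopic (C C' : Set Torus) : Prop :=
  ∃ Φ : unitInterval → (Torus ≃ₜ Torus),
    Continuous (fun a : unitInterval × Torus => Φ a.1 a.2) ∧
    (∀ a, Φ 0 a = a) ∧ Φ 1 '' C = C'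

/-- A curve in the torus has slope `s` if it is isotopic to a linear curve of slope `s`. -/
def HasSlope (C : Set Torus) (s : OnePoint ℚ) : Prop :=
  ∃ q : ℝ × ℝ, Isotopic C (toTorus '' line q s)

/-- The boundary of `S¹ × D²` is convex for `ker α` (there is a contact vector field near the
boundary and transverse to it), with a dividing set that consists of `n` curves of slope `s`. -/
def HasConvexBoundary (α : OneForm) (n : ℕ) (s : OnePoint ℚ) : Prop :=
  ∃ ε : ℝ, 0 < ε ∧ ∃ X : Ambient → Ambient, IsContactField α ε X ∧ IsTransverse X ∧
    (componentsOf (dividingSet α X)).encard = n ∧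
    ∀ C ∈ componentsOf (dividingSet α X), HasSlope C s

end SolidTorus

end

/-! Let `X` be a contact field transverse to the boundary and `X'` its translate under `c₃`. Since
`c₃` preserves the planes, `X'` is again a contact field (`IsContactField.translate`), with radial
component of the same sign. So every convex combination is transverse too, and its Hamiltonian `G s
= (1 - s) F + s F'` strictly increases, in a fixed direction of the characteristic foliation, along
its zero set (`fderiv_foliationField`). A dividing curve, where `G 0` vanishes, can therefore be
pushed along the foliation while `s` grows, ending as a loop in `{G (1/2) > 0}` in the same homotopy
class (`exists_loop_pos`).

Because `c₃` reverses the co-orientation, `F + F'` changes sign under `c₃`, so `{G (1/2) > 0}` is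
disjoint from its `c₃`-image. But a loop of class `(2k, 1)` meets its `c₃`-image: in the annulus `ℝ²
/ ℤ(2k, 1)` it has degree one, and translation by `(k, 1/2)` is a half turn that induces `c₃` on the
torus (`exists_eq_half_turn`). Slope `∞` is the case `k = 0`. -/

noncomputable section

open Filter Topology Set
open scoped Pointwise

/-! ### Plane topology: a winding argument in the annulus. -/

/-- Two continuous logarithms along a segment differ by a constant. -/
theorem sub_eq_log_sub_log_of_exp_eq {L c : ℝ → ℂ} (hL : Continuous L) (hc : Continuous c)
    (hLc : ∀ s, Complex.exp (L s) = c s) (h : ∀ s, c s ∈ Complex.slitPlane) :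
    L 1 - L 0 = Complex.log (c 1) - Complex.log (c 0) := by
  have hlog : Continuous fun s => Complex.log (c s) + (L 0 - Complex.log (c 0)) :=
    (continuous_iff_continuousAt.2 fun s => (hc.continuousAt).clog (h s)).add continuous_const
  have hne : ∀ s, c s ≠ 0 := fun s => Complex.slitPlane_ne_zero (h s)
  have key := Complex.isCoveringMap_exp.eq_of_comp_eq hL hlog (by
    funext s
    refine Subtype.ext ?_
    simp only [Function.comp]
    rw [Complex.exp_add, Complex.exp_sub, Complex.exp_log (hne _), Complex.exp_log (hne _),
      hLc, hLc, div_self (hne 0), mul_one]) 0 (by simp)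
  have := congrFun key 1
  beta_reduce at this
  rw [this]; ring

/-- A closed curve of degree one in an annulus meets its rotation by a half turn. -/
theorem exists_eq_half_turn {u θ : ℝ → ℝ} (hu : Continuous u) (hθ : Continuous θ)
    (hu1 : ∀ t, u (t + 1) = u t) (hθ1 : ∀ t, θ (t + 1) = θ t + 1) :
    ∃ t t', u t = u t' ∧ θ t = θ t' + 1 / 2 := by
  by_contra! hcon
  -- A zero of `e` is a coincidence of the curve with its half turn; without one, `e` has a
  -- continuous logarithm `L` on the plane.
  set e : ℝ × ℝ → ℂ := fun p => ⟨u (p.1 + p.2) - u p.1, θ (p.1 + p.2) - θ p.1 - 1 / 2⟩ with he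
  have hec : Continuous e := by
    have : e = fun p => ((u (p.1 + p.2) - u p.1 : ℝ) : ℂ)
        + ((θ (p.1 + p.2) - θ p.1 - 1 / 2 : ℝ) : ℂ) * Complex.I := by
      funext p; rw [he]; apply Complex.ext <;> simp
    rw [this]; fun_prop
  have hne : ∀ p, e p ≠ 0 := fun p h0 => by
    have h1 := congrArg Complex.re h0
    have h2 := congrArg Complex.im h0
    simp only [he, Complex.zero_re, Complex.zero_im] at h1 h2
    exact hcon (p.1 + p.2) p.1 (by linarith) (by linarith)
  obtain ⟨L, hLc, hL⟩ : ∃ L : ℝ × ℝ → ℂ, Continuous L ∧ ∀ p, Complex.exp (L p) = e p := by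
    obtain ⟨z, hz⟩ : ∃ z, Complex.exp z = e (0, 0) := ⟨_, Complex.exp_log (hne _)⟩
    obtain ⟨F, ⟨-, hF⟩, -⟩ := Complex.isCoveringMapOn_exp.existsUnique_continuousMap_lifts
      ⟨e, hec⟩ (a₀ := (0, 0)) (e₀ := z) hz (fun p => hne p)
    exact ⟨F, F.continuous, fun p => congrFun hF p⟩
  have e0 : ∀ t, e (t, 0) = ⟨0, -(1 / 2)⟩ := fun t => by simp [he]
  have e1 : ∀ t, e (t, 1) = ⟨0, 1 / 2⟩ := fun t => by
    simp only [he, hu1, hθ1]; apply Complex.ext <;> norm_num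
  -- The increment `L (t, 1) - L (t, 0)` is a logarithm of the fixed ratio `e (t, 1) / e (t, 0)`, so
  -- it does not depend on `t`.
  have hD := Complex.isCoveringMap_exp.eq_of_comp_eq
    (g₁ := fun t : ℝ => L (t, 1) - L (t, 0)) (g₂ := fun _ => L (0, 1) - L (0, 0))
    (by fun_prop) (by fun_prop) (by
      funext t
      refine Subtype.ext ?_
      simp only [Function.comp]
      rw [Complex.exp_sub, Complex.exp_sub, hL, hL, hL, hL, e0, e0, e1, e1]) 0 rfl
  have hper : Function.Periodic u 1 := hu1
  have hbd : ∀ t, ∃ t₁ ∈ Set.Icc (0 : ℝ) 1, u t₁ = u t := fun t => by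
    obtain ⟨y, hy, hyt⟩ := hper.exists_mem_Ico₀ one_pos t
    exact ⟨y, Set.Ico_subset_Icc_self hy, hyt.symm⟩
  obtain ⟨a, -, ha⟩ := isCompact_Icc.exists_isMinOn (Set.nonempty_Icc.2 (zero_le_one' ℝ))
    hu.continuousOn
  obtain ⟨b, -, hb⟩ := isCompact_Icc.exists_isMaxOn (Set.nonempty_Icc.2 (zero_le_one' ℝ))
    hu.continuousOn
  have ha' : ∀ t, u a ≤ u t := fun t => by
    obtain ⟨t₁, h1, h2⟩ := hbd t; rw [← h2]; exact ha h1
  have hb' : ∀ t, u t ≤ u b := fun t => by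
    obtain ⟨t₁, h1, h2⟩ := hbd t; rw [← h2]; exact hb h1
  have slit : ∀ z : ℂ, z ≠ 0 → 0 ≤ z.re → z ∈ Complex.slitPlane := fun z hz hr => by
    rw [Complex.mem_slitPlane_iff]
    rcases hr.lt_or_eq with h | h
    · exact Or.inl h
    · refine Or.inr fun hi => hz (Complex.ext h.symm hi)
  -- From `-i/2` to `i/2`, the path `e (a, ·)` stays in the right half plane, as `a` minimises `u`,
  -- while `e (b, ·)` stays in the left one: the increments are `πi` and `-πi`.
  have Da := sub_eq_log_sub_log_of_exp_eq (L := fun s => L (a, s)) (c := fun s => e (a, s))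
    (by fun_prop) (by fun_prop) (fun s => hL _)
    (fun s => slit _ (hne _) (sub_nonneg.2 (ha' (a + s))))
  have Db := sub_eq_log_sub_log_of_exp_eq (L := fun s => L (b, s) - Real.pi * Complex.I)
    (c := fun s => - e (b, s))
    (by fun_prop) (by fun_prop)
    (fun s => by rw [Complex.exp_sub, hL, Complex.exp_pi_mul_I, div_neg, div_one])
    (fun s => slit _ (neg_ne_zero.2 (hne _)) (by
      simp only [he, Complex.neg_re]; linarith [hb' (b + s)]))
  have hDa := congrFun hD a
  have hDb := congrFun hD b
  beta_reduce at hDa hDb Da Db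
  rw [e0, e1] at Da Db
  have i1 : (⟨0, 1 / 2⟩ : ℂ) = ((1 / 2 : ℝ) : ℂ) * Complex.I := by apply Complex.ext <;> simp
  have i2 : (⟨0, -(1 / 2)⟩ : ℂ) = ((1 / 2 : ℝ) : ℂ) * (-Complex.I) := by
    apply Complex.ext <;> simp
  rw [i1, i2, Complex.log_ofReal_mul (by norm_num) (by simp),
    Complex.log_ofReal_mul (by norm_num) (by simp), Complex.log_I, Complex.log_neg_I] at Da
  rw [i1, i2, ← mul_neg, ← mul_neg, neg_neg, Complex.log_ofReal_mul (by norm_num) (by simp),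
    Complex.log_ofReal_mul (by norm_num) (by simp), Complex.log_I, Complex.log_neg_I] at Db
  have h3 : L (a, 1) - L (a, 0) = L (b, 1) - L (b, 0) := hDa.trans hDb.symm
  have h4 : (Real.pi : ℂ) * Complex.I = -(Real.pi * Complex.I) := by
    linear_combination h3 - Da + Db
  have h5 := congrArg Complex.im h4
  simp at h5
  linarith [Real.pi_pos]

/-! ### Loops in the torus and lifts of isotopies. -/

namespace SolidTorus

theorem toTorus_eq_iff {q q' : ℝ × ℝ} :
    toTorus q = toTorus q' ↔ ∃ m n : ℤ, q' = (q.1 + m, q.2 + n) := by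
  have aux : ∀ a b : ℝ, (a : UnitAddCircle) = b ↔ ∃ m : ℤ, b = a + m := fun a b => by
    rw [eq_comm, QuotientAddGroup.eq_iff_sub_mem, AddSubgroup.mem_zmultiples_iff]
    exact exists_congr fun m => by simp [eq_comm (a := (m : ℝ)), sub_eq_iff_eq_add']
  simp only [toTorus, aux, Prod.ext_iff]
  constructor
  · rintro ⟨⟨m, hm⟩, n, hn⟩; exact ⟨m, n, hm, hn⟩
  · rintro ⟨m, n, hm, hn⟩; exact ⟨⟨m, hm⟩, n, hn⟩

theorem continuous_toTorus : Continuous toTorus := by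
  unfold toTorus
  exact ((AddCircle.continuous_mk' 1).comp continuous_fst).prodMk
    ((AddCircle.continuous_mk' 1).comp continuous_snd)

theorem isCoveringMap_unitAddCircle : IsCoveringMap ((↑) : ℝ → UnitAddCircle) :=
  AddCircle.isCoveringMap_coe 1

/-- A homotopy of maps `ℝ → ℝ/ℤ` that commutes with `t ↦ t + 1` lifts to a homotopy along which
the translation number is constant. -/
theorem exists_lift_of_homotopy (H : C(unitInterval × ℝ, UnitAddCircle)) (c : ℝ) (d : ℤ)
    (H_zero : ∀ t : ℝ, H (0, t) = ((c + t * d : ℝ) : UnitAddCircle))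
    (H_add : ∀ a t, H (a, t + 1) = H (a, t)) :
    ∃ g : ℝ → ℝ, Continuous g ∧ (∀ t, (g t : UnitAddCircle) = H (1, t)) ∧
      ∀ t, g (t + 1) = g t + d := by
  let f : C(ℝ, ℝ) := ⟨fun t => c + t * d, by fun_prop⟩
  let G := isCoveringMap_unitAddCircle.liftHomotopy H f H_zero
  have hG : ∀ p, (G p : UnitAddCircle) = H p := fun p =>
    congrFun (isCoveringMap_unitAddCircle.liftHomotopy_lifts H f H_zero) p
  have hG0 : ∀ t, G (0, t) = c + t * d := fun t =>
    isCoveringMap_unitAddCircle.liftHomotopy_zero H f H_zero t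
  refine ⟨fun t => G (1, t), by fun_prop, fun t => hG _, fun t => ?_⟩
  have key := isCoveringMap_unitAddCircle.eq_of_comp_eq
    (g₁ := fun a : unitInterval => G (a, t + 1)) (g₂ := fun a => G (a, t) + d)
    (by fun_prop) (by fun_prop) (by
      funext a
      simp only [Function.comp, AddCircle.coe_add]
      rw [hG, hG, H_add]
      have : ((d : ℝ) : UnitAddCircle) = 0 := by
        rw [AddCircle.coe_eq_zero_iff]; exact ⟨d, by simp⟩
      rw [this, add_zero]) 0 (by simp only [hG0]; ring)
  exact congrFun key 1

/-- A curve isotopic to a closed line contains a closed curve of the same homotopy class. -/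
theorem exists_loop_of_isotopic {C : Set Torus} {S : Set (ℝ × ℝ)} (h : Isotopic C (toTorus '' S))
    (q : ℝ × ℝ) (d e : ℤ) (hS : ∀ t : ℝ, (q.1 + t * d, q.2 + t * e) ∈ S) :
    ∃ g : ℝ → ℝ × ℝ, Continuous g ∧ (∀ t, toTorus (g t) ∈ C) ∧
      ∀ t, g (t + 1) = ((g t).1 + d, (g t).2 + e) := by
  obtain ⟨Φ, hΦ, h0, h1⟩ := h
  -- Joint continuity of the inverses `(Φ a).symm` holds because a continuous bijection from a
  -- compact to a Hausdorff space is a homeomorphism.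
  let E : unitInterval × Torus ≃ unitInterval × Torus :=
    { toFun := fun p => (p.1, Φ p.1 p.2)
      invFun := fun p => (p.1, (Φ p.1).symm p.2)
      left_inv := fun p => by simp
      right_inv := fun p => by simp }
  have hE : Continuous E := continuous_fst.prodMk hΦ
  have hE' : Continuous fun p : unitInterval × Torus => (Φ p.1).symm p.2 :=
    continuous_snd.comp (Continuous.homeoOfEquivCompactToT2 hE).symm.continuous
  let l : ℝ → ℝ × ℝ := fun t => (q.1 + t * d, q.2 + t * e)
  have hl : Continuous l := by fun_prop
  have hl1 : ∀ t, toTorus (l (t + 1)) = toTorus (l t) := fun t =>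
    (toTorus_eq_iff.2 ⟨d, e, by simp only [l, Prod.mk.injEq]; constructor <;> ring⟩).symm
  let H : unitInterval × ℝ → Torus := fun p => (Φ p.1).symm (toTorus (l p.2))
  have hH : Continuous H :=
    hE'.comp (continuous_fst.prodMk (continuous_toTorus.comp (hl.comp continuous_snd)))
  have hH0 : ∀ t, H (0, t) = toTorus (l t) := fun t => by
    simp only [H]; rw [Homeomorph.symm_apply_eq, h0]
  have hH1 : ∀ a t, H (a, t + 1) = H (a, t) := fun a t => by simp only [H, hl1]
  obtain ⟨g₁, hg₁, hg₁H, hg₁d⟩ := exists_lift_of_homotopy ⟨fun p => (H p).1, by fun_prop⟩ q.1 d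
    (fun t => by simp only [ContinuousMap.coe_mk, hH0]; rfl)
    (fun a t => by simp only [ContinuousMap.coe_mk, hH1])
  obtain ⟨g₂, hg₂, hg₂H, hg₂d⟩ := exists_lift_of_homotopy ⟨fun p => (H p).2, by fun_prop⟩ q.2 e
    (fun t => by simp only [ContinuousMap.coe_mk, hH0]; rfl)
    (fun a t => by simp only [ContinuousMap.coe_mk, hH1])
  refine ⟨fun t => (g₁ t, g₂ t), by fun_prop, fun t => ?_, fun t => by simp only [hg₁d, hg₂d]⟩
  have : toTorus (g₁ t, g₂ t) = H (1, t) := Prod.ext (hg₁H t) (hg₂H t)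
  have h2 : toTorus (l t) ∈ Φ 1 '' C := h1 ▸ Set.mem_image_of_mem _ (hS t)
  obtain ⟨c, hc, hct⟩ := h2
  rw [this]
  simp only [H]
  rw [← hct, Homeomorph.symm_apply_apply]
  exact hc

end SolidTorus

/-! ### Pushing loops through a family of functions. -/

/-- If `Y` increases the family `G s` along its zero set, then a short push along `Y` makes `G`
positive where it was nonnegative, even after a change of `s` of the order of its square. -/
theorem eventually_pos_of_pos_fderiv {E : Type*} [NormedAddCommGroup E] [NormedSpace ℝ E]
    {G : ℝ × E → ℝ} (hG : ContDiff ℝ 1 G) {Y : E → E} (hY : Continuous Y) (s₀ : ℝ) (q₀ : E) (κ₀ : ℝ)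
    (hGY : G (s₀, q₀) = 0 → 0 < fderiv ℝ G (s₀, q₀) (0, Y q₀)) :
    ∀ᶠ z : ℝ × ℝ × E × ℝ in 𝓝 (0, s₀, q₀, κ₀), 0 < z.1 → 0 ≤ G (z.2.1, z.2.2.1) →
      0 < G (z.2.1 + z.1 ^ 2 * z.2.2.2, z.2.2.1 + z.1 • Y z.2.2.1) := by
  have hGc := hG.continuous
  set a : ℝ × ℝ × E × ℝ → ℝ × E :=
    fun z => (z.2.1 + z.1 ^ 2 * z.2.2.2, z.2.2.1 + z.1 • Y z.2.2.1) with ha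
  set b : ℝ × ℝ × E × ℝ → ℝ × E := fun z => (z.2.1, z.2.2.1) with hb
  set v : ℝ × ℝ × E × ℝ → ℝ × E := fun z => (z.1 * z.2.2.2, Y z.2.2.1) with hv
  have hac : Continuous a := by fun_prop
  have hbc : Continuous b := by fun_prop
  have hvc : Continuous v := by fun_prop
  set z₀ : ℝ × ℝ × E × ℝ := (0, s₀, q₀, κ₀) with hz₀
  have ha0 : a z₀ = (s₀, q₀) := by simp [ha, hz₀]
  have hb0 : b z₀ = (s₀, q₀) := by simp [hb, hz₀]
  have hv0 : v z₀ = (0, Y q₀) := by simp [hv, hz₀]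
  rcases lt_trichotomy (G (s₀, q₀)) 0 with h | h | h
  · have : ∀ᶠ z in 𝓝 z₀, G (b z) < 0 :=
      (hGc.comp hbc).continuousAt.eventually_lt_const (by simpa [hb0] using h)
    filter_upwards [this] with z hz _ h'
    exact absurd h' (not_le.2 hz)
  -- The displacement is `τ • (τ κ, Y q)`, whose `s`-part is of second order. Strict
  -- differentiability makes the estimate uniform in the base point: the gain exceeds `τ m / 2` and
  -- the error is at most `τ m / 4`.
  · have hm := hGY h
    set D := fderiv ℝ G (s₀, q₀) with hD
    set m := D (0, Y q₀) with hm'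
    set M := ‖v z₀‖ + 1 with hM
    have hMpos : 0 < M := by positivity
    have e1 : ∀ᶠ z in 𝓝 z₀, m / 2 < D (v z) :=
      (D.continuous.comp hvc).continuousAt.eventually_const_lt (by
        simp only [Function.comp, hv0]; linarith)
    have e2 : ∀ᶠ z in 𝓝 z₀, ‖v z‖ < M :=
      hvc.norm.continuousAt.eventually_lt_const (by rw [hM]; linarith)
    have hstrict : HasStrictFDerivAt G D (s₀, q₀) :=
      (hG.contDiffAt).hasStrictFDerivAt one_ne_zero
    have htend : Tendsto (fun z => (a z, b z)) (𝓝 z₀) (𝓝 ((s₀, q₀), (s₀, q₀))) := by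
      have := (hac.prodMk hbc).tendsto z₀
      rwa [ha0, hb0] at this
    have e3 := htend.eventually (hstrict.isLittleO.def (c := m / (4 * M)) (by positivity))
    filter_upwards [e1, e2, e3] with z h1 h2 h3 hτ hpos
    have hab : a z - b z = z.1 • v z := by
      simp only [ha, hb, hv, Prod.mk_sub_mk, Prod.smul_mk, smul_eq_mul]
      congr 1
      · ring
      · abel
    simp only [hab, map_smul, norm_smul, Real.norm_eq_abs, abs_of_pos hτ, smul_eq_mul] at h3
    have h4 : m / (4 * M) * (z.1 * ‖v z‖) ≤ z.1 * (m / 4) := by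
      calc m / (4 * M) * (z.1 * ‖v z‖) ≤ m / (4 * M) * (z.1 * M) := by gcongr
        _ = z.1 * (m / 4) := by field_simp
    have h5 := (abs_le.1 h3).1
    have h6 : z.1 * (m / 2) < z.1 * D (v z) := by gcongr
    have h7 : 0 < z.1 * (m / 4) := by positivity
    have hpos' : 0 ≤ G (b z) := hpos
    change 0 < G (a z)
    linarith
  · have : ∀ᶠ z in 𝓝 z₀, 0 < G (a z) :=
      (hGc.comp hac).continuousAt.eventually_const_lt (by simpa [ha0] using h)
    filter_upwards [this] with z hz _ _
    exact hz

/-- Let `G s` be a family of functions on the torus such that `Y` increases `G s` along its zero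
set. Then a closed curve in `{G 0 ≥ 0}` can be homotoped into `{G (1 / 2) > 0}`. -/
theorem exists_loop_pos {G : ℝ × ℝ × ℝ → ℝ} (hG : ContDiff ℝ 1 G) {Y : ℝ × ℝ → ℝ × ℝ}
    (hY : Continuous Y)
    (hGper : ∀ s x y, ∀ m n : ℤ, G (s, x + m, y + n) = G (s, x, y))
    (hYper : ∀ x y, ∀ m n : ℤ, Y (x + m, y + n) = Y (x, y))
    (hGY : ∀ s ∈ Icc (0 : ℝ) 1, ∀ q, G (s, q) = 0 → 0 < fderiv ℝ G (s, q) (0, Y q))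
    {g : ℝ → ℝ × ℝ} (hg : Continuous g) (d e : ℤ) (hgd : ∀ t, g (t + 1) = ((g t).1 + d, (g t).2 + e))
    (hg0 : ∀ t, 0 ≤ G (0, g t)) :
    ∃ g' : ℝ → ℝ × ℝ, Continuous g' ∧ (∀ t, g' (t + 1) = ((g' t).1 + d, (g' t).2 + e)) ∧
      ∀ t, 0 < G (1 / 2, g' t) := by
  -- Compactness of the parameter interval, a fundamental square and the range of `κ` yields one
  -- step size `τ` for all points.
  have hK : IsCompact (Icc (0 : ℝ) 1 ×ˢ (Icc (0 : ℝ) 1 ×ˢ Icc (0 : ℝ) 1) ×ˢ Icc (-1 : ℝ) 1) :=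
    isCompact_Icc.prod ((isCompact_Icc.prod isCompact_Icc).prod isCompact_Icc)
  have key := hK.eventually_forall_of_forall_eventually (x₀ := (0 : ℝ))
    (P := fun τ w => 0 < τ → 0 ≤ G (w.1, w.2.1) →
      0 < G (w.1 + τ ^ 2 * w.2.2, w.2.1 + τ • Y w.2.1))
    (fun w hw => eventually_pos_of_pos_fderiv hG hY w.1 w.2.1 w.2.2 (hGY _ hw.1 _))
  obtain ⟨τ, hτ, hτpos⟩ :=
    ((key.filter_mono nhdsWithin_le_nhds).and (self_mem_nhdsWithin (s := Ioi (0 : ℝ)))).exists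
  have hτpos : 0 < τ := hτpos
  have step : ∀ s ∈ Icc (0 : ℝ) 1, ∀ κ ∈ Icc (-1 : ℝ) 1, ∀ q : ℝ × ℝ, 0 ≤ G (s, q) →
      0 < G (s + τ ^ 2 * κ, q + τ • Y q) := by
    intro s hs κ hκ q hq
    have e1 : q = (Int.fract q.1 + ⌊q.1⌋, Int.fract q.2 + ⌊q.2⌋) :=
      Prod.ext (Int.fract_add_floor _).symm (Int.fract_add_floor _).symm
    set x := Int.fract q.1
    set y := Int.fract q.2
    have hx : x ∈ Icc (0 : ℝ) 1 := ⟨Int.fract_nonneg _, (Int.fract_lt_one _).le⟩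
    have hy : y ∈ Icc (0 : ℝ) 1 := ⟨Int.fract_nonneg _, (Int.fract_lt_one _).le⟩
    have h1 := hτ (s, (x, y), κ) ⟨hs, ⟨hx, hy⟩, hκ⟩ hτpos (by
      rw [e1, hGper] at hq; exact hq)
    have e2 : q + τ • Y q = ((x + τ * (Y (x, y)).1) + ⌊q.1⌋, (y + τ * (Y (x, y)).2) + ⌊q.2⌋) := by
      conv_lhs => rw [e1, hYper]
      apply Prod.ext <;> simp <;> ring
    rw [e2, hGper]
    exact h1
  have chain : ∀ s ∈ Icc (0 : ℝ) 1, ∀ κ ∈ Icc (-1 : ℝ) 1,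
      (∃ g : ℝ → ℝ × ℝ, Continuous g ∧ (∀ t, g (t + 1) = ((g t).1 + d, (g t).2 + e)) ∧
        ∀ t, 0 ≤ G (s, g t)) →
      ∃ g : ℝ → ℝ × ℝ, Continuous g ∧ (∀ t, g (t + 1) = ((g t).1 + d, (g t).2 + e)) ∧
        ∀ t, 0 < G (s + τ ^ 2 * κ, g t) := by
    rintro s hs κ hκ ⟨g, hg, hgd, hgs⟩
    refine ⟨fun t => g t + τ • Y (g t), by fun_prop, fun t => ?_, fun t => step s hs κ hκ _ (hgs t)⟩
    beta_reduce
    rw [hgd, hYper]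
    apply Prod.ext <;> simp <;> ring
  -- `N` steps of length `1 / (2N) = τ² κ` lead from `0` to `1/2`; a large `N` ensures `κ ≤ 1`.
  obtain ⟨N, hN⟩ := exists_nat_gt (1 / (2 * τ ^ 2))
  have hN0 : (0 : ℝ) < N := lt_trans (by positivity) hN
  have hκ : 1 / (2 * τ ^ 2 * N) ∈ Icc (-1 : ℝ) 1 := by
    refine ⟨le_trans (by norm_num) (show (0 : ℝ) ≤ _ by positivity), ?_⟩
    rw [div_lt_iff₀ (by positivity)] at hN
    rw [div_le_one (by positivity)]
    linarith
  have hstep : ∀ i : ℕ, (i : ℝ) / (2 * N) + τ ^ 2 * (1 / (2 * τ ^ 2 * N)) = (i + 1 : ℕ) / (2 * N) := by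
    intro i; push_cast; field_simp
  have hmem : ∀ i : ℕ, i ≤ N → (i : ℝ) / (2 * N) ∈ Icc (0 : ℝ) 1 := fun i hi => by
    refine ⟨by positivity, ?_⟩
    rw [div_le_one (by positivity)]
    have : (i : ℝ) ≤ N := by exact_mod_cast hi
    linarith
  have ind : ∀ i : ℕ, i < N →
      ∃ g : ℝ → ℝ × ℝ, Continuous g ∧ (∀ t, g (t + 1) = ((g t).1 + d, (g t).2 + e)) ∧
        ∀ t, 0 < G ((i + 1 : ℕ) / (2 * N), g t) := by
    intro i
    induction i with
    | zero =>
      intro h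
      rw [← hstep]
      exact chain _ (hmem 0 h.le) _ hκ ⟨g, hg, hgd, by simpa using hg0⟩
    | succ i ih =>
      intro h
      obtain ⟨g₁, h1, h2, h3⟩ := ih (by omega)
      rw [← hstep]
      exact chain _ (hmem _ h.le) _ hκ ⟨g₁, h1, h2, fun t => (h3 t).le⟩
  have hN1 : 0 < N := by exact_mod_cast hN0
  have := ind (N - 1) (by omega)
  rwa [Nat.sub_add_cancel hN1, show (N : ℝ) / (2 * N) = 1 / 2 by field_simp] at this
-- Calculus on the cover, and the contact identities.
namespace SolidTorus

theorem cover_eq_prod : cover = (univ : Set ℝ) ×ˢ Metric.closedBall (0 : ℂ) 1 := by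
  ext p; simp [cover]

theorem uniqueDiffOn_cover : UniqueDiffOn ℝ cover := by
  rw [cover_eq_prod]
  refine uniqueDiffOn_univ.prod (uniqueDiffOn_convex (convex_closedBall _ _) ?_)
  rw [interior_closedBall _ one_ne_zero]
  exact ⟨0, by simp⟩

theorem vadd_cover (c : ℝ) : ((c, 0) : Ambient) +ᵥ cover = cover := by
  ext p
  rw [Set.mem_vadd_set_iff_neg_vadd_mem]
  simp [cover]

theorem add_mem_cover {p : Ambient} (hp : p ∈ cover) (c : ℝ) : p + (c, 0) ∈ cover := by
  simpa [cover] using hp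

theorem add_mem_collar {p : Ambient} {ε : ℝ} (hp : p ∈ collar ε) (c : ℝ) :
    p + (c, 0) ∈ collar ε := by
  simpa [collar] using hp

theorem fderivWithin_cover_translate {E : Type*} [NormedAddCommGroup E] [NormedSpace ℝ E]
    (f : Ambient → E) (c : ℝ) (p : Ambient) :
    fderivWithin ℝ (fun x => f (x + (c, 0))) cover p = fderivWithin ℝ f cover (p + (c, 0)) := by
  rw [fderivWithin_comp_add_right, vadd_cover]

theorem deck_eq (n : ℤ) (p : Ambient) : deck n p = p + ((n : ℝ), 0) := by
  simp [deck, Prod.ext_iff]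

theorem c3_eq (p : Ambient) : c3 p = p + (1 / 2, 0) := by
  simp [c3, Prod.ext_iff]

theorem fderiv_c3 (p v : Ambient) : fderiv ℝ c3 p v = v := by
  have : c3 = fun p => p + (1 / 2, 0) := funext c3_eq
  rw [this, fderiv_add_const]; simp

theorem collar_subset_cover (ε : ℝ) : collar ε ⊆ cover := fun _ hp => hp.2

theorem collar_mem_nhdsWithin {ε : ℝ} {p : Ambient} (hp : p ∈ collar ε) :
    collar ε ∈ 𝓝[cover] p := by
  have : {p : Ambient | 1 - ε < ‖p.2‖} ∈ 𝓝 p :=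
    (isOpen_lt continuous_const continuous_snd.norm).mem_nhds hp.1
  filter_upwards [mem_nhdsWithin_of_mem_nhds this, self_mem_nhdsWithin] with x h1 h2
  exact ⟨h1, h2⟩

/-- The collar is relatively open in the cover, so a field given only there can be differentiated
within the cover, as `lieD` requires. -/
theorem differentiableWithinAt_cover {E : Type*} [NormedAddCommGroup E]
    [NormedSpace ℝ E] {f : Ambient → E} {ε : ℝ}
    (hf : ContDiffOn ℝ ((⊤ : ℕ∞) : WithTop ℕ∞) f (collar ε)) {p : Ambient} (hp : p ∈ collar ε) :
    DifferentiableWithinAt ℝ f cover p :=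
  (hf.differentiableOn (by simp) p hp).mono_of_mem_nhdsWithin (collar_mem_nhdsWithin hp)

/-- If the Lie derivative along a field with value `x` and derivative `M` at `p` preserves
`ker α`, then `α ∧ dα` is expressed by the derivative of the contact Hamiltonian. -/
theorem wedgeD_of_lie_eq {α : OneForm} {p x : Ambient} {M : Ambient →L[ℝ] Ambient} {μ : ℝ}
    (h : ∀ v, fderivWithin ℝ α cover p x v + α p (M v) = μ * α p v) (hx : α p x = 0)
    (u v : Ambient) :
    wedgeD α p x u v = α p u * (fderivWithin ℝ α cover p v x + α p (M v))
      - α p v * (fderivWithin ℝ α cover p u x + α p (M u)) := by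
  simp only [wedgeD, extD, hx]
  linear_combination (α p v) * h u - (α p u) * h v

/-- The value of `α ∧ dα` on `x` and a frame of the torus through `p`. -/
theorem wedgeD_torus_frame (α : OneForm) (p x : Ambient) (z : ℂ) :
    wedgeD α p x (1, 0) (0, Complex.I * z)
      = -(inner ℝ z x.2) * wedgeD α p ((1, 0) : Ambient) ((0, 1) : Ambient)
        ((0, Complex.I) : Ambient) := by
  have hx : x = x.1 • ((1, 0) : Ambient) + x.2.re • ((0, 1) : Ambient)
      + x.2.im • ((0, Complex.I) : Ambient) := by
    refine Prod.ext ?_ (Complex.ext ?_ ?_) <;> simp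
  have hz : ((0, Complex.I * z) : Ambient) = (-z.im) • ((0, 1) : Ambient)
      + z.re • ((0, Complex.I) : Ambient) := by
    refine Prod.ext ?_ (Complex.ext ?_ ?_) <;> simp
  have hi : inner ℝ z x.2 = z.re * x.2.re + z.im * x.2.im := by
    simp [Complex.inner]; ring
  rw [hi, hz]
  generalize x.2.re = b at *
  generalize x.2.im = c at *
  generalize x.1 = a at *
  subst hx
  simp only [wedgeD, extD, map_add, map_smul, add_apply,
    smul_apply, smul_eq_mul]
  ring

/-- For a `c₃`-real contact form, `α` and `c₃^* α` differ by a smooth negative factor. -/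
theorem exists_smooth_factor {α : OneForm} (hα : IsContactForm α) (hc : IsC3Real α) :
    ∃ ρ : Ambient → ℝ, DifferentiableOn ℝ ρ cover ∧ ∀ p ∈ cover, ρ p < 0 ∧
      α p = ρ p • α (p + (1 / 2, 0)) := by
  let e : Fin 3 → Ambient := ![(1, 0), (0, 1), (0, Complex.I)]
  have hd : DifferentiableOn ℝ α cover := hα.1.1.differentiableOn (by simp)
  have hd' : DifferentiableOn ℝ (fun p => α (p + (1 / 2, 0))) cover := fun p hp => by
    have := hd _ (add_mem_cover hp (1 / 2))
    rw [differentiableWithinAt_comp_add_right, vadd_cover]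
    exact this
  have hpos : ∀ p ∈ cover, 0 < ∑ i, (α p (e i)) ^ 2 := fun p hp => by
    refine lt_of_le_of_ne (Finset.sum_nonneg fun i _ => sq_nonneg _) fun h0 => ?_
    have h1 := (Finset.sum_eq_zero_iff_of_nonneg fun i _ => sq_nonneg (α p (e i))).1 h0.symm
    have h2 : ∀ i, α p (e i) = 0 := fun i => by simpa using h1 i (Finset.mem_univ _)
    refine hα.2 p hp ?_
    have := h2 0; have := h2 1; have := h2 2
    simp_all [e, wedgeD]
  -- The factors `r` are only given pointwise. This projection quotient equals `-r⁻¹` and is visibly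
  -- differentiable.
  refine ⟨fun p => (∑ i, α p (e i) * α (p + (1 / 2, 0)) (e i))
    * (∑ i, (α (p + (1 / 2, 0)) (e i)) ^ 2)⁻¹, ?_, fun p hp => ?_⟩
  · refine DifferentiableOn.mul ?_
      (DifferentiableOn.fun_inv ?_ fun p hp => (hpos _ (add_mem_cover hp _)).ne')
    · exact DifferentiableOn.fun_sum fun i _ =>
        (hd.clm_apply (differentiableOn_const _)).mul (hd'.clm_apply (differentiableOn_const _))
    · exact DifferentiableOn.fun_sum fun i _ => (hd'.clm_apply (differentiableOn_const _)).pow 2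
  · obtain ⟨r, hr, h⟩ := hc p hp
    have hr0 := hr.ne'
    have h' : ∀ v, α p v = -r⁻¹ * α (p + (1 / 2, 0)) v := fun v => by
      have := h v
      rw [fderiv_c3, c3_eq] at this
      rw [this]; field_simp
    have : (∑ i, α p (e i) * α (p + (1 / 2, 0)) (e i))
        * (∑ i, (α (p + (1 / 2, 0)) (e i)) ^ 2)⁻¹ = -r⁻¹ := by
      rw [← div_eq_mul_inv, div_eq_iff (hpos _ (add_mem_cover hp _)).ne', Finset.mul_sum]
      exact Finset.sum_congr rfl fun i _ => by rw [h']; ring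
    simp only [this]
    refine ⟨by simpa using hr, ?_⟩
    exact ContinuousLinearMap.ext fun v => h' v

/-- The image of a contact field of a `c₃`-real contact structure under `c₃` is again a contact
field. -/
theorem IsContactField.translate {α : OneForm} (hα : IsContactForm α) (hc : IsC3Real α) {ε : ℝ}
    {X : Ambient → Ambient} (hX : IsContactField α ε X) :
    IsContactField α ε (fun p => X (p + (1 / 2, 0))) := by
  obtain ⟨ρ, hρ, hρα⟩ := exists_smooth_factor hα hc
  obtain ⟨hXd, hXp, μ, hμ⟩ := hX
  -- With `α = ρ c₃^*α`, the product rule gives `L_{X'} α = (X'ρ + ρ (μ ∘ c₃)) c₃^*α`, and `c₃^*α =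
  -- α / ρ`.
  refine ⟨?_, ?_, fun p => (fderivWithin ℝ ρ cover p (X (p + (1 / 2, 0)))
    + ρ p * μ (p + (1 / 2, 0))) / ρ p, ?_⟩
  · exact hXd.comp (by fun_prop) fun p hp => add_mem_collar hp _
  · intro p hp n
    have := hXp _ (add_mem_collar hp (1 / 2)) n
    rw [deck_eq] at this ⊢
    beta_reduce
    rw [add_right_comm, this]
  · intro p hp v
    have hpc := collar_subset_cover ε hp
    have hd' : DifferentiableWithinAt ℝ (fun p => α (p + (1 / 2, 0))) cover p := by
      have := hα.1.1.differentiableOn (by simp) _ (add_mem_cover hpc (1 / 2))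
      rw [differentiableWithinAt_comp_add_right, vadd_cover]
      exact this
    have hB : fderivWithin ℝ α cover p
        = ρ p • fderivWithin ℝ α cover (p + (1 / 2, 0))
          + (fderivWithin ℝ ρ cover p).smulRight (α (p + (1 / 2, 0))) := by
      rw [fderivWithin_congr (f₁ := α) (f := fun p => ρ p • α (p + (1 / 2, 0)))
        (fun x hx => (hρα x hx).2) (hρα p hpc).2,
        fderivWithin_fun_smul (uniqueDiffOn_cover p hpc) (hρ p hpc) hd',
        fderivWithin_cover_translate]
    have hl := hμ _ (add_mem_collar hp (1 / 2)) v
    have hρ0 := (hρα p hpc).1.ne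
    simp only [lieD] at hl ⊢
    rw [fderivWithin_cover_translate, hB, (hρα p hpc).2]
    simp only [add_apply, smul_apply,
      ContinuousLinearMap.smulRight_apply, smul_eq_mul]
    field_simp
    linear_combination ρ p * hl

/-! ### The boundary torus: Hamiltonians and characteristic foliation. -/

theorem norm_boundaryPoint_snd (q : ℝ × ℝ) : ‖(boundaryPoint q).2‖ = 1 := by
  have : 2 * (Real.pi : ℂ) * (q.1 : ℂ) * Complex.I = ((2 * Real.pi * q.1 : ℝ) : ℂ) * Complex.I := by
    push_cast; ring
  simp only [boundaryPoint]
  rw [this, Complex.norm_exp_ofReal_mul_I]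

theorem boundaryPoint_mem_collar {ε : ℝ} (hε : 0 < ε) (q : ℝ × ℝ) :
    boundaryPoint q ∈ collar ε := by
  simp only [collar, mem_ofPred_eq, norm_boundaryPoint_snd]
  exact ⟨by linarith, le_rfl⟩

theorem boundaryPoint_mem_cover (q : ℝ × ℝ) : boundaryPoint q ∈ cover :=
  (norm_boundaryPoint_snd q).le

theorem boundaryPoint_add_int (x y : ℝ) (m n : ℤ) :
    boundaryPoint (x + m, y + n) = deck n (boundaryPoint (x, y)) := by
  simp only [boundaryPoint, deck, Prod.mk.injEq, true_and]
  rw [Complex.exp_eq_exp_iff_exists_int]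
  exact ⟨m, by push_cast; ring⟩

theorem boundaryPoint_add_half (x y : ℝ) :
    boundaryPoint (x, y + 1 / 2) = boundaryPoint (x, y) + (1 / 2, 0) := by
  simp [boundaryPoint]

/-- The derivative of `boundaryPoint`. -/
def boundaryDeriv (q : ℝ × ℝ) : ℝ × ℝ →L[ℝ] Ambient :=
  (ContinuousLinearMap.snd ℝ ℝ ℝ).prod
    ((ContinuousLinearMap.fst ℝ ℝ ℝ).smulRight
      (2 * Real.pi * (Complex.I * (boundaryPoint q).2) : ℂ))

theorem hasFDerivAt_boundaryPoint (q : ℝ × ℝ) :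
    HasFDerivAt boundaryPoint (boundaryDeriv q) q := by
  refine HasFDerivAt.prodMk hasFDerivAt_snd ?_
  have h1 : HasDerivAt (fun x : ℝ => Complex.exp (2 * (Real.pi : ℂ) * (x : ℂ) * Complex.I))
      (2 * Real.pi * (Complex.I * (boundaryPoint q).2) : ℂ) q.1 := by
    have h2 : HasDerivAt (fun x : ℝ => 2 * (Real.pi : ℂ) * (x : ℂ) * Complex.I)
        (2 * (Real.pi : ℂ) * 1 * Complex.I) q.1 :=
      ((Complex.ofRealCLM.hasDerivAt (x := q.1)).const_mul _).mul_const _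
    convert h2.cexp using 1
    simp only [boundaryPoint]; ring
  exact h1.hasFDerivAt.comp q hasFDerivAt_fst

theorem contDiff_boundaryPoint : ContDiff ℝ 1 boundaryPoint := by
  unfold boundaryPoint
  refine contDiff_snd.prodMk ?_
  refine Complex.contDiff_exp.comp ?_
  refine ContDiff.mul (ContDiff.mul contDiff_const ?_) contDiff_const
  exact Complex.ofRealCLM.contDiff.comp contDiff_fst

/-- The contact Hamiltonian `α X` on the boundary torus. -/
def boundaryHamiltonian (α : OneForm) (X : Ambient → Ambient) (q : ℝ × ℝ) : ℝ :=
  α (boundaryPoint q) (X (boundaryPoint q))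

section

variable {α : OneForm} {X : Ambient → Ambient} {ε : ℝ}

theorem contDiff_boundaryHamiltonian (hα : IsContactForm α) (hε : 0 < ε)
    (hX : IsContactField α ε X) : ContDiff ℝ 1 (boundaryHamiltonian α X) := by
  have h1 : ContDiff ℝ 1 fun q => α (boundaryPoint q) :=
    contDiffOn_univ.1 ((hα.1.1.of_le (by exact_mod_cast le_top)).comp contDiff_boundaryPoint.contDiffOn
      fun q _ => boundaryPoint_mem_cover q)
  have h2 : ContDiff ℝ 1 fun q => X (boundaryPoint q) :=
    contDiffOn_univ.1 ((hX.1.of_le (by exact_mod_cast le_top)).comp contDiff_boundaryPoint.contDiffOn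
      fun q _ => boundaryPoint_mem_collar hε q)
  exact h1.clm_apply h2

theorem fderiv_boundaryHamiltonian (hα : IsContactForm α) (hε : 0 < ε)
    (hX : IsContactField α ε X) (q v : ℝ × ℝ) :
    fderiv ℝ (boundaryHamiltonian α X) q v
      = fderivWithin ℝ α cover (boundaryPoint q) (boundaryDeriv q v) (X (boundaryPoint q))
        + α (boundaryPoint q) (fderivWithin ℝ X cover (boundaryPoint q) (boundaryDeriv q v)) := by
  have hb := (hasFDerivAt_boundaryPoint q).hasFDerivWithinAt (s := univ)
  have hm : MapsTo boundaryPoint univ cover := fun q _ => boundaryPoint_mem_cover q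
  have h1 := ((hα.1.1.differentiableOn (by simp) _
    (boundaryPoint_mem_cover q)).hasFDerivWithinAt).comp q hb hm
  have h2 := ((differentiableWithinAt_cover hX.1
    (boundaryPoint_mem_collar hε q)).hasFDerivWithinAt).comp q hb hm
  have h3 := (h1.clm_apply h2).hasFDerivAt univ_mem
  have h4 : HasFDerivAt (boundaryHamiltonian α X) _ q := h3
  rw [h4.fderiv]
  simp [add_comm]

theorem boundaryHamiltonian_add_int (hα : IsContactForm α) (hε : 0 < ε)
    (hX : IsContactField α ε X) (x y : ℝ) (m n : ℤ) :
    boundaryHamiltonian α X (x + m, y + n) = boundaryHamiltonian α X (x, y) := by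
  simp only [boundaryHamiltonian]
  rw [boundaryPoint_add_int, hα.1.2 _ (boundaryPoint_mem_cover _),
    hX.2.1 _ (boundaryPoint_mem_collar hε _)]

/-- The density of `α ∧ dα` with respect to the standard frame. -/
def density (α : OneForm) (p : Ambient) : ℝ :=
  wedgeD α p ((1, 0) : Ambient) ((0, 1) : Ambient) ((0, Complex.I) : Ambient)

/-- A vector field on the torus that directs the characteristic foliation. -/
def foliationField (α : OneForm) (q : ℝ × ℝ) : ℝ × ℝ :=
  density α (boundaryPoint q) • (-α (boundaryPoint q) (1, 0),
    2 * Real.pi * α (boundaryPoint q) (0, Complex.I * (boundaryPoint q).2))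

theorem wedgeD_deck (hα : IsContactForm α) {p : Ambient} (hp : p ∈ cover) (n : ℤ)
    (u v w : Ambient) : wedgeD α (deck n p) u v w = wedgeD α p u v w := by
  have : fderivWithin ℝ α cover (deck n p) = fderivWithin ℝ α cover p := by
    rw [deck_eq, ← fderivWithin_cover_translate]
    refine fderivWithin_congr (fun x hx => ?_) ?_
    · rw [← deck_eq, hα.1.2 x hx]
    · rw [← deck_eq, hα.1.2 p hp]
  simp only [wedgeD, extD, this, hα.1.2 p hp]

theorem foliationField_add_int (hα : IsContactForm α) (x y : ℝ) (m n : ℤ) :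
    foliationField α (x + m, y + n) = foliationField α (x, y) := by
  simp only [foliationField, density]
  rw [boundaryPoint_add_int, wedgeD_deck hα (boundaryPoint_mem_cover _),
    hα.1.2 _ (boundaryPoint_mem_cover _)]
  rfl

/-- The cover has unique derivatives, so the first derivatives of `α` within it are continuous up to
the boundary. -/
theorem continuous_foliationField (hα : IsContactForm α) : Continuous (foliationField α) := by
  have hb := contDiff_boundaryPoint.continuous
  have h1 : Continuous fun q => α (boundaryPoint q) :=
    hα.1.1.continuousOn.comp_continuous hb boundaryPoint_mem_cover
  have h2 : Continuous fun q => fderivWithin ℝ α cover (boundaryPoint q) :=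
    (hα.1.1.continuousOn_fderivWithin uniqueDiffOn_cover (by simp)).comp_continuous hb
      boundaryPoint_mem_cover
  have h3 : ∀ u v : Ambient, Continuous fun q => fderivWithin ℝ α cover (boundaryPoint q) u v :=
    fun u v => (h2.clm_apply continuous_const).clm_apply continuous_const
  have h4 : ∀ u : Ambient, Continuous fun q => α (boundaryPoint q) u :=
    fun u => h1.clm_apply continuous_const
  have h5 : Continuous fun q => density α (boundaryPoint q) := by
    unfold density wedgeD extD
    exact (((h4 _).mul ((h3 _ _).sub (h3 _ _))).add ((h4 _).mul ((h3 _ _).sub (h3 _ _)))).add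
      ((h4 _).mul ((h3 _ _).sub (h3 _ _)))
  exact h5.smul ((h4 _).neg.prodMk (continuous_const.mul (h1.clm_apply (by fun_prop))))

/-- Along the zero set of a convex combination of the Hamiltonians of two contact fields, the
derivative in the direction of the characteristic foliation is a positive multiple of the convex
combination of the radial components. -/
theorem fderiv_foliationField (hα : IsContactForm α) (hε : 0 < ε) {X' : Ambient → Ambient}
    (hX : IsContactField α ε X) (hX' : IsContactField α ε X') (s : ℝ) (q : ℝ × ℝ)
    (h0 : (1 - s) * boundaryHamiltonian α X q + s * boundaryHamiltonian α X' q = 0) :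
    (1 - s) * fderiv ℝ (boundaryHamiltonian α X) q (foliationField α q)
        + s * fderiv ℝ (boundaryHamiltonian α X') q (foliationField α q)
      = 2 * Real.pi * density α (boundaryPoint q) ^ 2 *
        ((1 - s) * inner ℝ (boundaryPoint q).2 (X (boundaryPoint q)).2
          + s * inner ℝ (boundaryPoint q).2 (X' (boundaryPoint q)).2) := by
  obtain ⟨μ, hμ⟩ := hX.2.2
  obtain ⟨μ', hμ'⟩ := hX'.2.2
  have hp := boundaryPoint_mem_collar hε q
  rw [fderiv_boundaryHamiltonian hα hε hX, fderiv_boundaryHamiltonian hα hε hX']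
  simp only [boundaryHamiltonian] at h0
  have hT : boundaryDeriv q (foliationField α q) = (2 * Real.pi * density α (boundaryPoint q)) •
      (α (boundaryPoint q) (0, Complex.I * (boundaryPoint q).2) • ((1, 0) : Ambient)
        - α (boundaryPoint q) (1, 0) •
          ((0, Complex.I * (boundaryPoint q).2) : Ambient)) := by
    simp only [boundaryDeriv, foliationField, ContinuousLinearMap.prod_apply,
      ContinuousLinearMap.smulRight_apply, ContinuousLinearMap.coe_fst',
      ContinuousLinearMap.coe_snd', Prod.smul_mk, Prod.mk_sub_mk, smul_eq_mul,
      Complex.real_smul, Prod.mk.injEq]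
    constructor
    · ring
    · push_cast; ring
  rw [hT]
  set p := boundaryPoint q with hpq
  set u : Ambient := (1, 0) with hu
  set v : Ambient := (0, Complex.I * p.2) with hv
  set M := fderivWithin ℝ X cover p with hM
  set M' := fderivWithin ℝ X' cover p with hM'
  -- The contact condition is linear in the field, so the identity applies to the convex
  -- combination. The factor `density` in `foliationField` turns its density into a square, whatever
  -- the orientation.
  have key := wedgeD_of_lie_eq (α := α) (p := p) (x := (1 - s) • X p + s • X' p)
    (M := (1 - s) • M + s • M') (μ := (1 - s) * μ p + s * μ' p) (fun w => by
      have e1 := hμ p hp w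
      have e2 := hμ' p hp w
      simp only [lieD, ← hM, ← hM'] at e1 e2
      simp only [map_add, map_smul, add_apply, smul_apply, smul_eq_mul]
      linear_combination (1 - s) * e1 + s * e2)
    (by simpa only [map_add, map_smul, smul_eq_mul] using h0) u v
  rw [wedgeD_torus_frame] at key
  change _ * density α p = _ at key
  simp only [map_add, map_sub, map_smul, add_apply, sub_apply, smul_apply, smul_eq_mul,
    Prod.snd_add, Prod.smul_snd, inner_add_right, inner_smul_right] at key ⊢
  linear_combination (2 * Real.pi * density α p) * key

/-- The radial component of a field transverse to the boundary has constant sign. -/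
theorem IsTransverse.sign (hε : 0 < ε) (hX : IsContactField α ε X) (ht : IsTransverse X) :
    ∃ σ : ℝ, ∀ q, 0 < σ * inner ℝ (boundaryPoint q).2 (X (boundaryPoint q)).2 := by
  set ν : ℝ × ℝ → ℝ := fun q => inner ℝ (boundaryPoint q).2 (X (boundaryPoint q)).2 with hν
  have hb := contDiff_boundaryPoint.continuous
  have hc : Continuous ν :=
    (continuous_snd.comp hb).inner (continuous_snd.comp
      (hX.1.continuousOn.comp_continuous hb (boundaryPoint_mem_collar hε)))
  have hne : ∀ q, ν q ≠ 0 := fun q => ht _ (norm_boundaryPoint_snd q)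
  have hsign : ∀ q, 0 < ν 0 * ν q := fun q => by
    by_contra! hle
    have hle' := lt_of_le_of_ne hle (mul_ne_zero (hne 0) (hne q))
    obtain ⟨c, hc0⟩ := mem_range_of_exists_le_of_exists_ge (f := fun q => ν 0 * ν q) (c := 0)
      (by fun_prop) ⟨q, hle'.le⟩ ⟨0, mul_self_nonneg _⟩
    exact (mul_ne_zero (hne 0) (hne c)) hc0
  exact ⟨ν 0, hsign⟩

/-! ### The contradiction for the class `(2k, 1)`. -/

/-- A curve of the dividing set of a `c₃`-real contact structure is not in the class `(2 * k, 1)`. -/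
theorem not_hasSlope (hα : IsContactForm α) (hc : IsC3Real α) (hε : 0 < ε)
    (hX : IsContactField α ε X) (ht : IsTransverse X) (k : ℤ) {C : Set Torus}
    (hC : C ⊆ dividingSet α X) {S : Set (ℝ × ℝ)} (hCS : Isotopic C (toTorus '' S)) (q : ℝ × ℝ)
    (hS : ∀ t : ℝ, (q.1 + t * (2 * k), q.2 + t) ∈ S) : False := by
  have hX' := hX.translate hα hc
  set X' : Ambient → Ambient := fun p => X (p + (1 / 2, 0)) with hX'def
  set F := boundaryHamiltonian α X with hF
  set F' := boundaryHamiltonian α X' with hF'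
  have hFper : ∀ x y (m n : ℤ), F (x + m, y + n) = F (x, y) :=
    boundaryHamiltonian_add_int hα hε hX
  have hF'per : ∀ x y (m n : ℤ), F' (x + m, y + n) = F' (x, y) :=
    boundaryHamiltonian_add_int hα hε hX'
  have hFd : ContDiff ℝ 1 F := contDiff_boundaryHamiltonian hα hε hX
  have hF'd : ContDiff ℝ 1 F' := contDiff_boundaryHamiltonian hα hε hX'
  obtain ⟨g, hg, hgC, hgd⟩ := exists_loop_of_isotopic hCS q (2 * k) 1 (fun t => by
    have := hS t; push_cast; rwa [mul_one])
  have hgF : ∀ t, F (g t) = 0 := fun t => by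
    obtain ⟨q', hq', he⟩ := hC (hgC t)
    obtain ⟨m, n, hmn⟩ := toTorus_eq_iff.1 he
    rw [hmn, hFper]; exact hq'
  obtain ⟨σ, hσ⟩ := ht.sign hε hX
  let G : ℝ × ℝ × ℝ → ℝ := fun w => (1 - w.1) * F w.2 + w.1 * F' w.2
  have hG : ContDiff ℝ 1 G := by fun_prop
  have hGd : ∀ s q v, fderiv ℝ G (s, q) (0, v) = (1 - s) * fderiv ℝ F q v + s * fderiv ℝ F' q v := by
    intro s q v
    have h1 := (hFd.differentiable one_ne_zero q).hasFDerivAt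
    have h2 := (hF'd.differentiable one_ne_zero q).hasFDerivAt
    have hs : HasFDerivAt (fun q : ℝ × ℝ => ((s, q) : ℝ × ℝ × ℝ))
        (ContinuousLinearMap.inr ℝ ℝ (ℝ × ℝ)) q := hasFDerivAt_prodMk_right s q
    have h3 := ((hG.differentiable one_ne_zero (s, q)).hasFDerivAt.comp q hs).unique
      ((h1.const_mul (1 - s)).add (h2.const_mul s))
    simpa using congrArg (fun f => f v) h3
  obtain ⟨g', hg', hg'd, hg'pos⟩ := exists_loop_pos hG (Y := fun q => σ • foliationField α q)
    ((continuous_foliationField hα).const_smul σ)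
    (fun s x y m n => by simp only [G, hFper, hF'per])
    (fun x y m n => by simp only [foliationField_add_int hα])
    (fun s hs q h0 => by
      rw [hGd, map_smul, map_smul, smul_eq_mul, smul_eq_mul, mul_left_comm, mul_left_comm s,
        ← mul_add, fderiv_foliationField hα hε hX hX' s q h0]
      have hd : 0 < density α (boundaryPoint q) ^ 2 :=
        sq_pos_of_ne_zero (hα.2 _ (boundaryPoint_mem_cover q))
      have i1 := hσ q
      -- The radial component of `X'` at `q` is that of `X` at the `c₃`-translate, with the same
      -- `z`.
      have i2 := hσ (q.1, q.2 + 1 / 2)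
      rw [boundaryPoint_add_half] at i2
      simp only [Prod.snd_add, add_zero] at i2
      have i3 : 0 < (1 - s) * (σ * inner ℝ (boundaryPoint q).2 (X (boundaryPoint q)).2)
          + s * (σ * inner ℝ (boundaryPoint q).2 (X' (boundaryPoint q)).2) := by
        rcases hs.1.lt_or_eq with h | h
        · exact add_pos_of_nonneg_of_pos (mul_nonneg (sub_nonneg.2 hs.2) i1.le) (mul_pos h i2)
        · rw [← h]; simpa using i1
      have := mul_pos (mul_pos Real.two_pi_pos hd) i3
      linarith)
    hg (2 * k) 1 hgd (fun t => by simp [G, hgF])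
  obtain ⟨ρ, -, hρ⟩ := exists_smooth_factor hα hc
  -- Since `c₃` applied twice is a deck translation, it exchanges `X` and `X'`; the factor `ρ` is
  -- negative.
  have hhalf : ∀ x y, F (x, y) + F' (x, y)
      = ρ (boundaryPoint (x, y)) * (F (x, y + 1 / 2) + F' (x, y + 1 / 2)) := by
    intro x y
    have hp := boundaryPoint_mem_cover (x, y)
    have hd := hX.2.1 _ (boundaryPoint_mem_collar hε (x, y)) 1
    have hb : boundaryPoint (x, y) + (1 / 2, 0) + (1 / 2, 0) = deck 1 (boundaryPoint (x, y)) := by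
      rw [deck_eq, add_assoc]; norm_num
    simp only [hF, hF', boundaryHamiltonian, hX'def, boundaryPoint_add_half, hb, hd]
    rw [(hρ _ hp).2]
    simp only [smul_apply, smul_eq_mul]
    ring
  -- In the coordinates `(x - 2ky, y)` the loop is closed of degree one in an annulus. Equal `u` and
  -- `θ` differing by `1/2` mean a translation by `(k, 1/2)`, which is `c₃` on the torus as `k` is
  -- an integer.
  obtain ⟨t, t', hu, hy⟩ := exists_eq_half_turn
    (u := fun t => (g' t).1 - 2 * k * (g' t).2) (θ := fun t => (g' t).2) (by fun_prop) (by fun_prop)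
    (fun t => by rw [hg'd]; push_cast; ring) (fun t => by rw [hg'd]; push_cast; ring)
  have hgt : g' t = ((g' t').1 + k, ((g' t').2 + 1 / 2) + (0 : ℤ)) := by
    refine Prod.ext ?_ ?_
    · rw [hy] at hu
      dsimp only
      linarith
    · dsimp only
      rw [hy]; simp
  have p1 := hg'pos t
  have p2 := hg'pos t'
  simp only [G] at p1 p2
  rw [hgt, hFper, hF'per] at p1
  have h3 := hhalf (g' t').1 (g' t').2
  have h4 := (hρ _ (boundaryPoint_mem_cover ((g' t').1, (g' t').2))).1
  have h5 : 0 < F ((g' t').1, (g' t').2) + F' ((g' t').1, (g' t').2) := by linarith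
  have h6 : 0 < F ((g' t').1, (g' t').2 + 1 / 2) + F' ((g' t').1, (g' t').2 + 1 / 2) := by linarith
  rw [h3] at h5
  linarith [mul_neg_of_neg_of_pos h4 h6]

end

/-- The dividing set of a `c₃`-real contact structure does not consist of curves in the class
`(2 * k, 1)`. -/
theorem not_hasConvexBoundary {α : OneForm} (hα : IsContactForm α) (hc : IsC3Real α) (k : ℤ)
    {n : ℕ} (hn : n ≠ 0) {s : OnePoint ℚ}
    (hs : ∀ q : ℝ × ℝ, ∀ t : ℝ, (q.1 + t * (2 * k), q.2 + t) ∈ line q s) :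
    ¬ HasConvexBoundary α n s := by
  rintro ⟨ε, hε, X, hX, ht, hcard, hslope⟩
  have hne : (componentsOf (dividingSet α X)).Nonempty := by
    rw [nonempty_iff_ne_empty]
    intro h0
    rw [h0, encard_empty] at hcard
    exact hn (by exact_mod_cast hcard.symm)
  obtain ⟨C, hCΓ⟩ := hne
  obtain ⟨q, hq⟩ := hslope C hCΓ
  obtain ⟨q₀, -, rfl⟩ := hCΓ
  exact not_hasSlope hα hc hε hX ht k (connectedComponentIn_subset _ _) hq q (hs q)

end SolidTorus

end

theorem corollary4p5 :
    (¬ ∃ α : SolidTorus.OneForm,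
      SolidTorus.IsContactForm α ∧ SolidTorus.IsC3Real α ∧ SolidTorus.IsTight α ∧
        SolidTorus.HasConvexBoundary α 2 OnePoint.infty) ∧
    ∀ k : ℤ, k ≠ 0 →
      ¬ ∃ α : SolidTorus.OneForm,
        SolidTorus.IsContactForm α ∧ SolidTorus.IsC3Real α ∧ SolidTorus.IsTight α ∧
          SolidTorus.HasConvexBoundary α 2 (((1 / (2 * k) : ℚ)) : OnePoint ℚ) := by
  refine ⟨?_, fun k hk => ?_⟩
  · rintro ⟨α, hα, hc, -, h⟩
    refine SolidTorus.not_hasConvexBoundary hα hc 0 two_ne_zero (fun q t => ?_) h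
    simp [SolidTorus.line]
  · rintro ⟨α, hα, hc, -, h⟩
    refine SolidTorus.not_hasConvexBoundary hα hc k two_ne_zero (fun q t => ?_) h
    have hk' : (k : ℝ) ≠ 0 := by exact_mod_cast hk
    change q.2 + t - q.2 = ((1 / (2 * k) : ℚ) : ℝ) * (q.1 + t * (2 * k) - q.1)
    push_cast
    field_simp
    ring
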